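/- Alphabets are finite sets. A transducer over an alphabet $\Gamma$ is a finite automaton over the monoid $\Gamma^*\times\Gamma^*$ with one initial state and labels in $(\Gamma\cup\{\varepsilon\})\times(\Gamma\cup\{\varepsilon\})$; it is synchronous if all its labels lie in $\Gamma\times\Gamma$. A rational graph $G$ labelled by an alphabet $\Sigma$ with vertices in $\Gamma^*$ is given by transducers $(T_a)_{a\in\Sigma}$ over $\Gamma$: there is an edge $u\xrightarrow{a}v$ if and only if $T_a$ accepts $(u,v)$. It is synchronous if it is given by synchronous transducers, and of finite out-degree if every vertex is the source of only finitely many edges. For sets $I,F$ of vertices, $L(G,I,F)$ is the set of all words $w\in\Sigma^*$ that label a path of $G$ from a vertex in $I$ to a vertex in $F$ (the empty word labels the empty path from any vertex to itself). **Proposition.** Let $G$ be a synchronous rational graph labelled by $\Sigma$ with vertices in $\Gamma^*$, and let $I,F\subseteq\Gamma^*$ be rational (i.e. regular) sets with $I\cap F=\emptyset$. Then there are a finite alphabet $\Gamma'\supseteq\Gamma$, a rational graph $H$ of finite out-degree labelled by $\Sigma$ with vertices in $\Gamma'^*$, and a vertex $i\in\Gamma'^*$ such that $$L(G,I,F)=L(H,\{i\},F).$$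 -/

import Mathlib

universe u v

/-- A (finite) word transducer over the alphabet `Γ`: a finite automaton over the product monoid
`Γ* × Γ*` with one initial state and labels in `(Γ ∪ {ε}) × (Γ ∪ {ε})`, where `none` stands for
the empty word `ε`. (Over a finite alphabet there are automatically finitely many transitions.) -/
structure Transducer (Γ : Type u) where
  State : Type
  finite_state : Finite State
  init : State
  final : Set State
  step : State → Option Γ → Option Γ → State → Prop

namespace Transducer

variable {Γ : Type u}

/-- `T.Run p x y q`: there is a run of `T` from `p` to `q` labelled by the pair of words `(x, y)`,
the product of the labels of its transitions. -/
inductive Run (T : Transducer Γ) : T.State → List Γ → List Γ → T.State → Prop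
  | nil (q : T.State) : Run T q [] [] q
  | cons {p q r : T.State} {x y : Option Γ} {u v : List Γ} :
      T.step p x y q → Run T q u v r → Run T p (x.toList ++ u) (y.toList ++ v) r

/-- The rational relation on words accepted by `T`. -/
def Accepts (T : Transducer Γ) (x y : List Γ) : Prop :=
  ∃ q ∈ T.final, T.Run T.init x y q

/-- A transducer is synchronous if all its labels are in `Γ × Γ`. -/
def IsSynchronous (T : Transducer Γ) : Prop :=
  ∀ p x y q, T.step p x y q → x.isSome ∧ y.isSome

end Transducer

/-- A rational graph labelled by `A` with vertices in `Γ*`, given by a tuple `(T_a)` of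
transducers over `Γ`, one for each label `a`. -/
structure RationalGraph (A : Type u) (Γ : Type v) where
  T : A → Transducer Γ

namespace RationalGraph

variable {A : Type u} {Γ : Type v}

/-- There is an edge labelled `a` from `x` to `y` if and only if `T_a` accepts `(x, y)`. -/
def Edge (G : RationalGraph A Γ) (x : List Γ) (a : A) (y : List Γ) : Prop :=
  (G.T a).Accepts x y

/-- `G.Path s w t`: there is a path from `s` to `t` with path label `w`. -/
inductive Path (G : RationalGraph A Γ) : List Γ → List A → List Γ → Prop
  | nil (s : List Γ) : Path G s [] s
  | cons {s t r : List Γ} {a : A} {w : List A} :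
      G.Edge s a t → Path G t w r → Path G s (a :: w) r

/-- The path language `L(G, I, F)`. -/
def language (G : RationalGraph A Γ) (I F : Language Γ) : Language A :=
  {w : List A | ∃ s ∈ I, ∃ t ∈ F, G.Path s w t}

/-- A synchronous rational graph is one that is given by synchronous transducers. -/
def IsSynchronous (G : RationalGraph A Γ) : Prop :=
  ∀ a, (G.T a).IsSynchronous

/-- Every vertex is the source of finitely many edges. -/
def FiniteOutDegree (G : RationalGraph A Γ) : Prop :=
  ∀ s : List Γ, {e : A × List Γ | G.Edge s e.1 e.2}.Finite

end RationalGraph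

/-! The start of a path, chosen among infinitely many words of `I`, must be guessed in bounded
space. Composing automata for `I` and `F` with the transducers along `w` yields a transducer with at
most `|σ| * q ^ |w| * |τ|` states, where `q` bounds the sizes of all `T_a`. A run without repeated
states shows that a label `w` of a path from `I` to `F` also labels one whose start is shorter than
this number (`exists_path_length_lt`).

So padding that is multiplied by a constant `C` at each edge soon has room for the start, but every
such edge spends a letter of `w`. These letters are queued during the first half of `w`; in the
second half each edge of `H` simulates two edges of `G`, so that queue and input run out together
(`path_grow`, `path_process`). Conversely, every path of `H` ending in a word over `Γ` unfolds to a
path of `G`, whenever the growth stops (`path_sound`).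

Queue operations and two synchronous steps compose to a rational relation (`isRational_queueEdge`),
and an edge lengthens a vertex at most linearly, whence the finite out-degree
(`QueueEdge.length_le`). Disjointness of `I` and `F` excludes the empty word, which no path from the
padding to `F` can read. -/

namespace Transducer

variable {Γ : Type u}

/-! ### Runs of transducers -/

theorem Run.trans {T : Transducer Γ} {p q r : T.State} {x y u v : List Γ}
    (h₁ : T.Run p x y q) (h₂ : T.Run q u v r) : T.Run p (x ++ u) (y ++ v) r := by
  induction h₁ with
  | nil => exact h₂
  | cons hs _ ih => simpa only [List.append_assoc] using Run.cons hs (ih h₂)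

theorem Run.single {T : Transducer Γ} {p q : T.State} {x y : Option Γ} (h : T.step p x y q) :
    T.Run p x.toList y.toList q := by
  simpa using Run.cons h (Run.nil q)

theorem Run.head_silent {T : Transducer Γ} {p q r : T.State} {x y : List Γ}
    (h : T.step p none none q) (hr : T.Run q x y r) : T.Run p x y r :=
  Run.cons h hr

/-- A map of states that preserves transitions preserves runs. -/
theorem Run.map {S T : Transducer Γ} (f : S.State → T.State)
    (hf : ∀ p x y q, S.step p x y q → T.step (f p) x y (f q)) {p q : S.State} {x y : List Γ}
    (h : S.Run p x y q) : T.Run (f p) x y (f q) := by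
  induction h with
  | nil => exact Run.nil _
  | cons hs _ ih => exact Run.cons (hf _ _ _ _ hs) ih

theorem Run.length_eq {T : Transducer Γ} (hT : T.IsSynchronous) {p q : T.State} {x y : List Γ}
    (h : T.Run p x y q) : x.length = y.length := by
  induction h with
  | nil => rfl
  | cons hs _ ih =>
    obtain ⟨hx, hy⟩ := hT _ _ _ _ hs
    obtain ⟨a, rfl⟩ := Option.isSome_iff_exists.1 hx
    obtain ⟨b, rfl⟩ := Option.isSome_iff_exists.1 hy
    simp [ih]

/-! ### Rational relations and their closure properties -/

/-- A relation on words is rational if it is accepted by a transducer. -/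
def IsRational (R : List Γ → List Γ → Prop) : Prop :=
  ∃ T : Transducer Γ, ∀ x y, T.Accepts x y ↔ R x y

/-- The concatenation product of two relations on words. -/
def Cat (R S : List Γ → List Γ → Prop) (x y : List Γ) : Prop :=
  ∃ x₁ x₂ y₁ y₂, x = x₁ ++ x₂ ∧ y = y₁ ++ y₂ ∧ R x₁ y₁ ∧ S x₂ y₂

/-- The Kleene star of a relation on words. -/
inductive Star (R : List Γ → List Γ → Prop) : List Γ → List Γ → Prop
  | nil : Star R [] []
  | cons {x y u v : List Γ} : R x y → Star R u v → Star R (x ++ u) (y ++ v)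

inductive LetterStep (x y : Option Γ) : Bool → Option Γ → Option Γ → Bool → Prop
  | mk : LetterStep x y false x y true

/-- The transducer accepting just the label `(x, y)`. -/
def letter (x y : Option Γ) : Transducer Γ where
  State := Bool
  finite_state := inferInstance
  init := false
  final := {true}
  step := LetterStep x y

theorem isRational_letter (x y : Option Γ) :
    IsRational fun u v => u = x.toList ∧ v = y.toList := by
  refine ⟨letter x y, fun u v => ⟨?_, ?_⟩⟩
  · rintro ⟨q, rfl, h⟩
    have key : ∀ {p q : (letter x y).State} {u v : List Γ}, (letter x y).Run p u v q → q = Bool.true →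
        (p = Bool.false → u = x.toList ∧ v = y.toList) ∧ (p = Bool.true → u = [] ∧ v = []) := by
      intro p q u v h
      induction h with
      | nil q => rintro rfl; simp
      | cons hs _ ih =>
        intro hq
        cases hs
        obtain ⟨rfl, rfl⟩ := (ih hq).2 rfl
        exact ⟨fun _ => by simp, by rintro ⟨⟩⟩
    exact (key h rfl).1 rfl
  · rintro ⟨rfl, rfl⟩
    exact ⟨true, rfl, Run.single (T := letter x y) LetterStep.mk⟩

inductive CatStep (S T : Transducer Γ) :
    S.State ⊕ T.State → Option Γ → Option Γ → S.State ⊕ T.State → Prop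
  | left {p x y q} : S.step p x y q → CatStep S T (.inl p) x y (.inl q)
  | right {p x y q} : T.step p x y q → CatStep S T (.inr p) x y (.inr q)
  | jump {p} : p ∈ S.final → CatStep S T (.inl p) none none (.inr T.init)

/-- The transducer for a concatenation product. -/
def cat (S T : Transducer Γ) : Transducer Γ where
  State := S.State ⊕ T.State
  finite_state := by
    have := S.finite_state
    have := T.finite_state
    infer_instance
  init := .inl S.init
  final := {s | ∃ q ∈ T.final, s = .inr q}
  step := CatStep S T

theorem IsRational.cat {R R' : List Γ → List Γ → Prop} (h : IsRational R) (h' : IsRational R') :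
    IsRational (Cat R R') := by
  obtain ⟨S, hS⟩ := h
  obtain ⟨T, hT⟩ := h'
  refine ⟨S.cat T, fun x y => ⟨?_, ?_⟩⟩
  · rintro ⟨_, ⟨q, hq, rfl⟩, h⟩
    -- A run that starts in the copy of `S` is cut at its only jump; one that starts in the copy of
    -- `T` stays there.
    have key : ∀ {s t : (S.cat T).State} {x y : List Γ}, (S.cat T).Run s x y t → t = .inr q →
        (∀ p, s = .inr p → T.Run p x y q) ∧
        (∀ p, s = .inl p → Cat (fun u v => ∃ f ∈ S.final, S.Run p u v f) R' x y) := by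
      intro s t x y h
      induction h with
      | nil => rintro rfl; exact ⟨by rintro _ ⟨⟩; exact Run.nil q, by rintro _ ⟨⟩⟩
      | cons hs _ ih =>
        intro ht
        cases hs with
        | left h1 =>
          refine ⟨by simp, ?_⟩
          rintro _ ⟨⟩
          obtain ⟨x₁, x₂, y₁, y₂, rfl, rfl, ⟨f, hf, hr⟩, h2⟩ := (ih ht).2 _ rfl
          exact ⟨_, x₂, _, y₂, by rw [List.append_assoc], by rw [List.append_assoc],
            ⟨f, hf, Run.cons h1 hr⟩, h2⟩
        | right h1 =>
          refine ⟨?_, by simp⟩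
          rintro _ ⟨⟩
          exact Run.cons h1 ((ih ht).1 _ rfl)
        | jump h1 =>
          refine ⟨by simp, ?_⟩
          rintro _ ⟨⟩
          exact ⟨[], _, [], _, rfl, rfl, ⟨_, h1, Run.nil _⟩,
            (hT _ _).1 ⟨q, hq, (ih ht).1 _ rfl⟩⟩
    obtain ⟨x₁, x₂, y₁, y₂, rfl, rfl, hr, h2⟩ := (key h rfl).2 _ rfl
    exact ⟨x₁, x₂, y₁, y₂, rfl, rfl, (hS _ _).1 hr, h2⟩
  · rintro ⟨x₁, x₂, y₁, y₂, rfl, rfl, h1, h2⟩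
    obtain ⟨f, hf, h1⟩ := (hS _ _).2 h1
    obtain ⟨g, hg, h2⟩ := (hT _ _).2 h2
    refine ⟨.inr g, ⟨g, hg, rfl⟩, ?_⟩
    refine Run.trans (T := S.cat T) (q := .inl f)
      (h1.map (T := S.cat T) .inl fun _ _ _ _ h => CatStep.left h) ?_
    exact Run.head_silent (T := S.cat T) (CatStep.jump hf)
      (h2.map (T := S.cat T) .inr fun _ _ _ _ h => CatStep.right h)

/-- The extra state `none` is both initial and accepting, and is revisited between factors. The
initial state of `T` cannot play this role, since it may be re-entered in the middle of a factor. -/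
inductive StarStep (T : Transducer Γ) :
    Option T.State → Option Γ → Option Γ → Option T.State → Prop
  | inner {p x y q} : T.step p x y q → StarStep T (some p) x y (some q)
  | enter : StarStep T none none none (some T.init)
  | exit {p} : p ∈ T.final → StarStep T (some p) none none none

/-- The transducer for a Kleene star. -/
def star (T : Transducer Γ) : Transducer Γ where
  State := Option T.State
  finite_state := by
    have := T.finite_state
    infer_instance
  init := none
  final := {none}
  step := StarStep T

theorem IsRational.star {R : List Γ → List Γ → Prop} (h : IsRational R) :
    IsRational (Star R) := by
  obtain ⟨T, hT⟩ := h
  refine ⟨T.star, fun x y => ⟨?_, fun h => ⟨none, rfl, ?_⟩⟩⟩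
  · rintro ⟨_, rfl, h⟩
    have key : ∀ {s t : T.star.State} {x y : List Γ}, T.star.Run s x y t → t = none →
        (s = none → Star R x y) ∧
        (∀ p, s = some p → Cat (fun u v => ∃ f ∈ T.final, T.Run p u v f) (Star R) x y) := by
      intro s t x y h
      induction h with
      | nil => rintro rfl; exact ⟨fun _ => Star.nil, by rintro _ ⟨⟩⟩
      | cons hs _ ih =>
        intro ht
        cases hs with
        | inner h1 =>
          refine ⟨by simp, ?_⟩
          rintro _ ⟨⟩
          obtain ⟨x₁, x₂, y₁, y₂, rfl, rfl, ⟨f, hf, hr⟩, h2⟩ := (ih ht).2 _ rfl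
          exact ⟨_, x₂, _, y₂, by rw [List.append_assoc], by rw [List.append_assoc],
            ⟨f, hf, Run.cons h1 hr⟩, h2⟩
        | enter =>
          refine ⟨fun _ => ?_, by simp⟩
          obtain ⟨x₁, x₂, y₁, y₂, rfl, rfl, hr, h2⟩ := (ih ht).2 _ rfl
          change Star R (x₁ ++ x₂) (y₁ ++ y₂)
          exact Star.cons ((hT x₁ y₁).1 hr) h2
        | exit h1 =>
          refine ⟨by simp, ?_⟩
          rintro _ ⟨⟩
          exact ⟨[], _, [], _, rfl, rfl, ⟨_, h1, Run.nil _⟩, (ih ht).1 rfl⟩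
    exact (key h rfl).1 rfl
  · induction h with
    | nil => exact Run.nil _
    | cons h1 _ ih =>
      obtain ⟨f, hf, h1⟩ := (hT _ _).2 h1
      refine Run.head_silent (T := T.star) StarStep.enter ?_
      refine Run.trans (T := T.star)
        (h1.map (T := T.star) some fun _ _ _ _ h => StarStep.inner h) ?_
      exact Run.head_silent (T := T.star) (StarStep.exit hf) ih

inductive SumStep {ι : Type} (T : ι → Transducer Γ) :
    Option (Σ i, (T i).State) → Option Γ → Option Γ → Option (Σ i, (T i).State) → Prop
  | enter (i) : SumStep T none none none (some ⟨i, (T i).init⟩)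
  | inner {i p x y q} : (T i).step p x y q → SumStep T (some ⟨i, p⟩) x y (some ⟨i, q⟩)

/-- The transducer for a finite union. -/
def sum {ι : Type} [Finite ι] (T : ι → Transducer Γ) : Transducer Γ where
  State := Option (Σ i, (T i).State)
  finite_state := by
    have := fun i => (T i).finite_state
    infer_instance
  init := none
  final := {s | ∃ i, ∃ q ∈ (T i).final, s = some ⟨i, q⟩}
  step := SumStep T

theorem IsRational.iUnion {ι : Type} [Finite ι] {R : ι → List Γ → List Γ → Prop}
    (h : ∀ i, IsRational (R i)) : IsRational fun x y => ∃ i, R i x y := by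
  choose T hT using h
  refine ⟨sum T, fun x y => ⟨?_, ?_⟩⟩
  · rintro ⟨_, ⟨i, q, hq, rfl⟩, h⟩
    have key : ∀ {s t : (sum T).State} {x y : List Γ}, (sum T).Run s x y t →
        t = some ⟨i, q⟩ →
        (∀ j p, s = some ⟨j, p⟩ → ∃ f ∈ (T j).final, (T j).Run p x y f) ∧
        (s = none → ∃ j, R j x y) := by
      intro s t x y h
      induction h with
      | nil =>
        rintro rfl
        refine ⟨?_, by simp⟩
        rintro _ _ ⟨⟩
        exact ⟨q, hq, Run.nil q⟩
      | cons hs _ ih =>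
        intro ht
        cases hs with
        | enter j =>
          exact ⟨by simp, fun _ => ⟨j, (hT j _ _).1 ((ih ht).1 _ _ rfl)⟩⟩
        | inner h1 =>
          refine ⟨?_, by simp⟩
          rintro _ _ ⟨⟩
          obtain ⟨f, hf, hr⟩ := (ih ht).1 _ _ rfl
          exact ⟨f, hf, Run.cons h1 hr⟩
    exact (key h rfl).2 rfl
  · rintro ⟨i, h⟩
    obtain ⟨f, hf, h⟩ := (hT i _ _).2 h
    exact ⟨some ⟨i, f⟩, ⟨i, f, hf, rfl⟩, Run.head_silent (T := sum T) (SumStep.enter i)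
      (h.map (T := sum T) (fun p => some ⟨i, p⟩) fun _ _ _ _ h => SumStep.inner h)⟩

theorem IsRational.congr {R S : List Γ → List Γ → Prop} (h : IsRational R)
    (hRS : ∀ x y, R x y ↔ S x y) : IsRational S := by
  obtain ⟨T, hT⟩ := h
  exact ⟨T, fun x y => (hT x y).trans (hRS x y)⟩

theorem IsRational.or {R S : List Γ → List Γ → Prop} (hR : IsRational R) (hS : IsRational S) :
    IsRational fun x y => R x y ∨ S x y :=
  (IsRational.iUnion (R := fun b : Bool => if b then R else S)
    (by rintro (_ | _) <;> simpa)).congr (by simp [or_comm])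

theorem isRational_singleton (x y : List Γ) : IsRational fun u v => u = x ∧ v = y := by
  induction x with
  | nil =>
    induction y with
    | nil => exact isRational_letter none none
    | cons b y ih =>
      exact ((isRational_letter none (some b)).cat ih).congr (by simp [Cat, and_comm])
  | cons a x ih =>
    exact ((isRational_letter (some a) none).cat ih).congr (by simp [Cat])

/-- The relation between the images of the same word under two morphisms is rational. -/
theorem isRational_flatMap {ι : Type} [Finite ι] (f g : ι → List Γ) :
    IsRational fun x y => ∃ l : List ι, x = l.flatMap f ∧ y = l.flatMap g := by
  refine (IsRational.iUnion fun i => isRational_singleton (f i) (g i)).star.congr fun x y =>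
    ⟨fun h => ?_, ?_⟩
  · induction h with
    | nil => exact ⟨[], rfl, rfl⟩
    | cons h _ ih =>
      obtain ⟨i, rfl, rfl⟩ := h
      obtain ⟨l, rfl, rfl⟩ := ih
      exact ⟨i :: l, rfl, rfl⟩
  · rintro ⟨l, rfl, rfl⟩
    induction l with
    | nil => exact Star.nil
    | cons i l ih => exact Star.cons ⟨i, rfl, rfl⟩ ih

/-! ### Composition with synchronous transducers -/

/-- A synchronous `T` has no silent moves: it waits when `S` writes nothing and otherwise consumes
the written letter at once, so two kinds of steps suffice. -/
inductive CompStep {Λ : Type v} (S : Transducer Λ) (T : Transducer Γ) (f : Γ → Λ) :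
    S.State × T.State → Option Λ → Option Λ → S.State × T.State → Prop
  | idle {p x q s} : S.step p x none q → CompStep S T f (p, s) x none (q, s)
  | move {p x q s g h t} : S.step p x (some (f g)) q → T.step s (some g) (some h) t →
      CompStep S T f (p, s) x (some (f h)) (q, t)

/-- Composition of a transducer `S` with a synchronous transducer `T`, whose letters are renamed
by `f`. -/
def comp {Λ : Type v} (S : Transducer Λ) (T : Transducer Γ) (f : Γ → Λ) : Transducer Λ where
  State := S.State × T.State
  finite_state := by
    have := S.finite_state
    have := T.finite_state
    infer_instance
  init := (S.init, T.init)
  final := S.final ×ˢ T.final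
  step := CompStep S T f

theorem IsSynchronous.run_cons {T : Transducer Γ} (hT : T.IsSynchronous) {p q : T.State}
    {x y : List Γ} (h : T.Run p x y q) :
    (x = [] → y = [] ∧ p = q) ∧
      ∀ a u, x = a :: u → ∃ b v r, y = b :: v ∧ T.step p (some a) (some b) r ∧ T.Run r u v q := by
  cases h with
  | nil => simp
  | cons hs hr =>
    obtain ⟨hx, hy⟩ := hT _ _ _ _ hs
    obtain ⟨a, rfl⟩ := Option.isSome_iff_exists.1 hx
    obtain ⟨b, rfl⟩ := Option.isSome_iff_exists.1 hy
    refine ⟨by simp, ?_⟩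
    rintro _ _ ⟨⟩
    exact ⟨b, _, _, rfl, hs, hr⟩

theorem accepts_comp {Λ : Type v} (S : Transducer Λ) (T : Transducer Γ) (hT : T.IsSynchronous)
    (f : Γ → Λ) (x y : List Λ) : (S.comp T f).Accepts x y ↔
      ∃ u v, y = List.map f v ∧ S.Accepts x (u.map f) ∧ T.Accepts u v := by
  constructor
  · rintro ⟨q, hq, h⟩
    have key : ∀ {s t : (S.comp T f).State} {x y : List Λ}, (S.comp T f).Run s x y t →
        ∃ u v, y = List.map f v ∧ S.Run s.1 x (u.map f) t.1 ∧ T.Run s.2 u v t.2 := by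
      intro s t x y h
      induction h with
      | nil s => exact ⟨[], [], rfl, Run.nil _, Run.nil _⟩
      | cons hs _ ih =>
        obtain ⟨u, v, rfl, h1, h2⟩ := ih
        cases hs with
        | idle h => exact ⟨u, v, rfl, Run.cons h h1, h2⟩
        | move h h' => exact ⟨_ :: u, _ :: v, rfl, Run.cons h h1, Run.cons h' h2⟩
    obtain ⟨u, v, rfl, h1, h2⟩ := key h
    exact ⟨u, v, rfl, ⟨_, hq.1, h1⟩, ⟨_, hq.2, h2⟩⟩
  · rintro ⟨u, v, rfl, ⟨p, hp, h1⟩, ⟨q, hq, h2⟩⟩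
    refine ⟨(p, q), ⟨hp, hq⟩, ?_⟩
    have key : ∀ {p p' : S.State} {x w : List Λ}, S.Run p x w p' →
        ∀ {u v s}, w = List.map f u → T.Run s u v q → (S.comp T f).Run (p, s) x (v.map f) (p', q) := by
      intro p p' x w h
      induction h with
      | nil =>
        intro u v s hu hr
        obtain ⟨rfl, rfl⟩ := (hT.run_cons hr).1 (List.map_eq_nil_iff.1 hu.symm)
        exact Run.nil (T := S.comp T f) _
      | @cons _ _ _ _ y _ _ hs _ ih =>
        intro u v s hu hr
        cases y with
        | none => exact Run.cons (T := S.comp T f) (y := none) (CompStep.idle hs) (ih hu hr)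
        | some c =>
          obtain ⟨a, u, rfl, rfl, rfl⟩ := List.map_eq_cons_iff.1 hu.symm
          obtain ⟨b, v, r, rfl, hs', hr'⟩ := (hT.run_cons hr).2 _ _ rfl
          exact Run.cons (T := S.comp T f) (CompStep.move hs hs') (ih rfl hr')
    exact key h1 rfl h2

end Transducer

namespace Transducer

variable {Γ : Type u}

/-! ### Short runs -/

/-- A walk avoiding `S` may be cut after its last visit of `p`. -/
theorem reflTransGen_avoid {σ : Type*} {r : σ → σ → Prop} (S : Set σ) (p : σ) {a q : σ}
    (h : Relation.ReflTransGen (fun b c => r b c ∧ c ∉ S) a q) :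
    Relation.ReflTransGen (fun b c => r b c ∧ c ∉ insert p S) a q ∨ q = p ∨
      ∃ p', r p p' ∧ p' ∉ insert p S ∧
        Relation.ReflTransGen (fun b c => r b c ∧ c ∉ insert p S) p' q := by
  induction h with
  | refl => exact .inl .refl
  | @tail b c _ hbc ih =>
    by_cases hc : c = p
    · exact .inr (.inl hc)
    have hc' : c ∉ insert p S := by simp [hc, hbc.2]
    rcases ih with h | rfl | ⟨p', h1, h2, h3⟩
    · exact .inl (h.tail ⟨hbc.1, hc'⟩)
    · exact .inr (.inr ⟨c, hbc.1, hc', .refl⟩)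
    · exact .inr (.inr ⟨p', h1, h2, h3.tail ⟨hbc.1, hc'⟩⟩)

/-- `S` collects the states already left for good. Cutting the walk after its last visit of `p`
allows `p` to join `S`, so the induction is on the number of states outside `S`, and each transition
reads at most one letter. -/
theorem exists_run_of_reflTransGen (T : Transducer Γ) (S : Finset T.State) {p q : T.State}
    (hp : p ∉ S) (h : Relation.ReflTransGen
      (fun b c => (∃ x y, T.step b x y c) ∧ c ∉ (S : Set T.State)) p q) :
    ∃ x y, T.Run p x y q ∧ x.length + S.card < Nat.card T.State := by
  classical
  have := T.finite_state
  have := Fintype.ofFinite T.State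
  rw [Nat.card_eq_fintype_card]
  have hlt : S.card < Fintype.card T.State := by
    have := Finset.card_le_univ (insert p S)
    rw [Finset.card_insert_of_notMem hp] at this
    omega
  induction hn : Fintype.card T.State - S.card generalizing S p with
  | zero => omega
  | succ n ih =>
    by_cases hpq : q = p
    · subst hpq
      exact ⟨[], [], Run.nil q, by simpa using hlt⟩
    have key : ∃ p', (∃ x y, T.step p x y p') ∧ p' ∉ insert p (S : Set T.State) ∧
        Relation.ReflTransGen (fun b c => (∃ x y, T.step b x y c) ∧
          c ∉ insert p (S : Set T.State)) p' q := by
      rcases reflTransGen_avoid (S : Set T.State) p h with h | h | h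
      · rcases h.cases_head with h | ⟨p', h1, h2⟩
        · exact absurd h.symm hpq
        · exact ⟨p', h1.1, h1.2, h2⟩
      · exact absurd h hpq
      · exact h
    obtain ⟨p', ⟨x, y, hs⟩, hp', h'⟩ := key
    rw [← Finset.coe_insert] at hp' h'
    have hc := Finset.card_insert_of_notMem hp
    have hlt' : (insert p S).card < Fintype.card T.State := by
      have := Finset.card_le_univ (insert p' (insert p S))
      rw [Finset.card_insert_of_notMem (by simpa using hp')] at this
      omega
    obtain ⟨u, v, hr, hl⟩ := ih (insert p S) (by simpa using hp') h' hlt' (by omega)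
    refine ⟨_, _, Run.cons hs hr, ?_⟩
    have : x.toList.length ≤ 1 := by cases x <;> simp
    simp only [List.length_append]
    omega

/-- A transducer that accepts something accepts a pair whose input is shorter than its number of
states. -/
theorem exists_accepts_length_lt (T : Transducer Γ) {x y : List Γ} (h : T.Accepts x y) :
    ∃ u v, T.Accepts u v ∧ u.length < Nat.card T.State := by
  obtain ⟨q, hq, h⟩ := h
  have hr : ∀ {p : T.State} {x y}, T.Run p x y q → Relation.ReflTransGen
      (fun b c => (∃ x y, T.step b x y c) ∧ c ∉ ((∅ : Finset T.State) : Set T.State)) p q := by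
    intro p x y h
    induction h with
    | nil => exact .refl
    | cons hs _ ih => exact .head ⟨⟨_, _, hs⟩, by simp⟩ (ih hq ‹_›)
  obtain ⟨u, v, hr, hl⟩ := exists_run_of_reflTransGen T ∅ (by simp) (hr h)
  exact ⟨u, v, ⟨q, hq, hr⟩, by simpa using hl⟩

/-! ### Transducers for regular languages -/

inductive DiagonalStep {Λ : Type v} {σ : Type} (M : DFA Γ σ) (f : Γ → Λ) :
    σ → Option Λ → Option Λ → σ → Prop
  | mk (p a) : DiagonalStep M f p (some (f a)) (some (f a)) (M.step p a)

/-- The transducer accepting `(f u, f u)` for all `u` accepted by `M`. -/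
def diagonal {Λ : Type v} {σ : Type} [Finite σ] (M : DFA Γ σ) (f : Γ → Λ) : Transducer Λ where
  State := σ
  finite_state := inferInstance
  init := M.start
  final := M.accept
  step := DiagonalStep M f

theorem diagonal_isSynchronous {Λ : Type v} {σ : Type} [Finite σ] (M : DFA Γ σ) (f : Γ → Λ) :
    (diagonal M f).IsSynchronous := by
  rintro _ _ _ _ ⟨⟩
  simp

theorem accepts_diagonal {Λ : Type v} {σ : Type} [Finite σ] (M : DFA Γ σ) (f : Γ → Λ)
    (x y : List Λ) : (diagonal M f).Accepts x y ↔ ∃ u ∈ M.accepts, x = u.map f ∧ y = u.map f := by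
  constructor
  · rintro ⟨q, hq, h⟩
    have key : ∀ {p q : (diagonal M f).State} {x y}, (diagonal M f).Run p x y q →
        ∃ u, M.evalFrom p u = q ∧ x = u.map f ∧ y = u.map f := by
      intro p q x y h
      induction h with
      | nil => exact ⟨[], rfl, rfl, rfl⟩
      | cons hs _ ih =>
        obtain ⟨u, h, rfl, rfl⟩ := ih
        cases hs with
        | mk a => exact ⟨a :: u, h, rfl, rfl⟩
    obtain ⟨u, rfl, hx, hy⟩ := key h
    exact ⟨u, hq, hx, hy⟩
  · rintro ⟨u, hu, rfl, rfl⟩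
    have key : ∀ (u : List Γ) (p : σ),
        (diagonal M f).Run p (u.map f) (u.map f) (M.evalFrom p u) := by
      intro u
      induction u with
      | nil => exact fun p => Run.nil (T := diagonal M f) p
      | cons a u ih =>
        exact fun p => Run.cons (T := diagonal M f) (DiagonalStep.mk p a) (ih _)
    exact ⟨_, hu, key u _⟩

theorem isRational_map_diagonal {Λ : Type v} (f : Γ → Λ) :
    IsRational fun x y => ∃ u : List Γ, x = u.map f ∧ y = u.map f :=
  ⟨diagonal (⟨fun _ _ => (), (), Set.univ⟩ : DFA Γ Unit) f, fun x y => by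
    simp [accepts_diagonal, DFA.mem_accepts]⟩

inductive FillStep {Λ : Type v} {σ : Type} (M : DFA Γ σ) (c : Λ) (f : Γ → Λ) :
    σ → Option Λ → Option Λ → σ → Prop
  | write (p a) : FillStep M c f p (some c) (some (f a)) (M.step p a)
  | skip (p) : FillStep M c f p (some c) none p

/-- The transducer that replaces a word `c ^ m` by a word of length at most `m` accepted by `M`. -/
def fill {Λ : Type v} {σ : Type} [Finite σ] (M : DFA Γ σ) (c : Λ) (f : Γ → Λ) :
    Transducer Λ where
  State := σ
  finite_state := inferInstance
  init := M.start
  final := M.accept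
  step := FillStep M c f

theorem accepts_fill {Λ : Type v} {σ : Type} [Finite σ] (M : DFA Γ σ) (c : Λ) (f : Γ → Λ)
    (x y : List Λ) : (fill M c f).Accepts x y ↔
      ∃ m, ∃ u ∈ M.accepts, x = List.replicate m c ∧ y = u.map f ∧ u.length ≤ m := by
  constructor
  · rintro ⟨q, hq, h⟩
    have key : ∀ {p q : (fill M c f).State} {x y}, (fill M c f).Run p x y q →
        ∃ m u, M.evalFrom p u = q ∧ x = List.replicate m c ∧ y = u.map f ∧ u.length ≤ m := by
      intro p q x y h
      induction h with
      | nil => exact ⟨0, [], rfl, rfl, rfl, le_rfl⟩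
      | cons hs _ ih =>
        obtain ⟨m, u, h, rfl, rfl, hl⟩ := ih
        cases hs with
        | write a => exact ⟨m + 1, a :: u, h, rfl, rfl, Nat.succ_le_succ hl⟩
        | skip => exact ⟨m + 1, u, h, rfl, rfl, hl.trans m.le_succ⟩
    obtain ⟨m, u, rfl, hx, hy, hl⟩ := key h
    exact ⟨m, u, hq, hx, hy, hl⟩
  · rintro ⟨m, u, hu, rfl, rfl, hl⟩
    have key : ∀ (m : ℕ) (u : List Γ) (p : σ), u.length ≤ m →
        (fill M c f).Run p (List.replicate m c) (u.map f) (M.evalFrom p u) := by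
      intro m
      induction m with
      | zero =>
        intro u p hl
        obtain rfl := List.length_eq_zero_iff.1 (Nat.le_zero.1 hl)
        exact Run.nil (T := fill M c f) p
      | succ m ih =>
        rintro (_ | ⟨a, u⟩) p hl
        · exact Run.cons (T := fill M c f) (FillStep.skip p) (ih [] p (Nat.zero_le m))
        · exact Run.cons (T := fill M c f) (FillStep.write p a)
            (ih u _ (Nat.le_of_succ_le_succ hl))
    exact ⟨_, hu, key m u _ hl⟩

end Transducer

/-! ### Paths of synchronous graphs and their short representatives -/

namespace RationalGraph

variable {A : Type u} {Γ : Type v}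

theorem IsSynchronous.length_eq {G : RationalGraph A Γ} (hG : G.IsSynchronous) {s t : List Γ}
    {w : List A} (h : G.Path s w t) : s.length = t.length := by
  induction h with
  | nil => rfl
  | cons he _ ih =>
    obtain ⟨q, _, hr⟩ := he
    exact (hr.length_eq (hG _)).trans ih

theorem Path.trans {G : RationalGraph A Γ} {r s t : List Γ} {w z : List A}
    (h₁ : G.Path r w s) (h₂ : G.Path s z t) : G.Path r (w ++ z) t := by
  induction h₁ with
  | nil => exact h₂
  | cons he _ ih => exact .cons he (ih h₂)

theorem path_append {G : RationalGraph A Γ} {r t : List Γ} {w z : List A} :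
    G.Path r (w ++ z) t ↔ ∃ s, G.Path r w s ∧ G.Path s z t := by
  refine ⟨fun h => ?_, fun ⟨s, h₁, h₂⟩ => h₁.trans h₂⟩
  induction w generalizing r with
  | nil => exact ⟨r, .nil r, h⟩
  | cons a w ih =>
    cases h with
    | cons he h =>
      obtain ⟨s, h₁, h₂⟩ := ih h
      exact ⟨s, .cons he h₁, h₂⟩

/-- Composing a transducer with the relation `x →[w] y` of a synchronous rational graph. -/
theorem exists_transducer_path {Λ : Type*} {G : RationalGraph A Γ} (hG : G.IsSynchronous) {q : ℕ}
    (hq : ∀ a, Nat.card (G.T a).State ≤ q) {f : Γ → Λ} (hf : Function.Injective f) (w : List A)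
    (S : Transducer Λ) (hS : ∀ x y, S.Accepts x y → ∃ v, y = List.map f v) :
    ∃ T : Transducer Λ, Nat.card T.State ≤ Nat.card S.State * q ^ w.length ∧
      ∀ x y, T.Accepts x y ↔
        ∃ u v, y = List.map f v ∧ S.Accepts x (u.map f) ∧ G.Path u w v := by
  induction w generalizing S with
  | nil =>
    refine ⟨S, by simp, fun x y => ⟨fun h => ?_, ?_⟩⟩
    -- For the empty label nothing is composed, so only `hS` ensures that the output is an image
    -- under `f`.
    · obtain ⟨v, rfl⟩ := hS x y h
      exact ⟨v, v, rfl, h, .nil v⟩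
    · rintro ⟨u, v, rfl, h, ⟨⟩⟩
      exact h
  | cons a w ih =>
    obtain ⟨T, hT, h⟩ := ih (S.comp (G.T a) f) fun x y h => by
      obtain ⟨_, v, rfl, _⟩ := (Transducer.accepts_comp _ _ (hG a) _ _ _).1 h
      exact ⟨v, rfl⟩
    refine ⟨T, hT.trans ?_, fun x y => (h x y).trans ⟨?_, ?_⟩⟩
    · have : Nat.card (S.comp (G.T a) f).State = Nat.card S.State * Nat.card (G.T a).State :=
        Nat.card_prod _ _
      rw [this, List.length_cons, pow_succ', mul_assoc]
      gcongr
      exact hq a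
    · rintro ⟨u, v, rfl, h, hp⟩
      obtain ⟨u', v', huv, h1, h2⟩ := (Transducer.accepts_comp _ _ (hG a) _ _ _).1 h
      obtain rfl := List.map_injective_iff.2 hf huv
      exact ⟨u', v, rfl, h1, .cons h2 hp⟩
    · rintro ⟨u, v, rfl, h, hp⟩
      cases hp with
      | cons he hp =>
        exact ⟨_, v, rfl, (Transducer.accepts_comp _ _ (hG a) _ _ _).2 ⟨u, _, rfl, h, he⟩, hp⟩

/-- A path of a synchronous rational graph between regular sets can be replaced by one with the
same label between words of length exponential in that of the label. -/
theorem exists_path_length_lt {G : RationalGraph A Γ} (hG : G.IsSynchronous) {q : ℕ}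
    (hq : ∀ a, Nat.card (G.T a).State ≤ q) {σ τ : Type} [Finite σ] [Finite τ]
    (M : DFA Γ σ) (N : DFA Γ τ) {s t : List Γ} {w : List A} (h : G.Path s w t)
    (hs : s ∈ M.accepts) (ht : t ∈ N.accepts) :
    ∃ s' ∈ M.accepts, ∃ t' ∈ N.accepts, G.Path s' w t' ∧
      s'.length < Nat.card σ * q ^ w.length * Nat.card τ := by
  -- `M` checks the start, the transducers along `w` follow the path, and `N` checks its end. The
  -- input of the composite is the start of the path, so a short input is what is needed.
  obtain ⟨T, hT, hacc⟩ := exists_transducer_path hG hq Function.injective_id w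
    (Transducer.diagonal M id) (by simp)
  have hN := Transducer.accepts_comp T _ (Transducer.diagonal_isSynchronous N id) id
  obtain ⟨x, y, hxy, hl⟩ := Transducer.exists_accepts_length_lt (T.comp (.diagonal N id) id)
    ((hN s t).2 ⟨t, t, by simp, (hacc _ _).2 ⟨s, t, by simp,
      (Transducer.accepts_diagonal _ _ _ _).2 ⟨s, hs, by simp⟩, h⟩,
      (Transducer.accepts_diagonal _ _ _ _).2 ⟨t, ht, by simp⟩⟩)
  obtain ⟨u, v, rfl, h1, h2⟩ := (hN _ _).1 hxy
  obtain ⟨u', v', huv, h3, h4⟩ := (hacc _ _).1 h1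
  simp only [Transducer.accepts_diagonal, List.map_id] at h2 h3 huv
  obtain ⟨_, hv, rfl, rfl⟩ := h2
  obtain ⟨_, hu, rfl, rfl⟩ := h3
  subst huv
  refine ⟨_, hu, _, hv, h4, hl.trans_le ?_⟩
  refine (Nat.card_prod _ _).trans_le ?_
  exact Nat.mul_le_mul_right _ hT

end RationalGraph

namespace RationalGraph

variable {A : Type u} {Γ : Type v}

/-! ### The graph of finite out-degree

A vertex consists of a queue of edge labels followed by a row, which is a word over `Γ` or a block
of padding letters. During the first half of a path, labels are enqueued and the padding grows
exponentially. Then each edge enqueues its own label and follows two edges of the original graph,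
whose labels it dequeues; the first such edge replaces the padding by a word of `I`. -/

/-- The alphabet of the vertices. -/
inductive Letter (n : ℕ) (Γ : Type v) : Type v
  | queue (b : Fin n)
  | row (g : Γ)
  | pad

namespace Letter

/-- Letters as elements of a sum type. -/
def toSum {n : ℕ} : Letter n Γ → Fin n ⊕ Option Γ
  | queue b => .inl b
  | row g => .inr (some g)
  | pad => .inr none

theorem toSum_injective {n : ℕ} : Function.Injective (toSum : Letter n Γ → _) := by
  rintro (_ | _ | _) (_ | _ | _) h <;> simp_all [toSum]

instance {n : ℕ} [Finite Γ] : Finite (Letter n Γ) := Finite.of_injective _ toSum_injective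

theorem row_injective {n : ℕ} : Function.Injective (row : Γ → Letter n Γ) := fun _ _ h => by
  simpa using h

end Letter

open Letter

variable {n : ℕ}

/-- The queue containing the word `α`. -/
def queueWord (Γ : Type v) (enc : A ≃ Fin n) (α : List A) : List (Letter n Γ) :=
  α.map fun a => queue (enc a)

/-- The row `r` represents the word `u`, possibly chosen in `I`. -/
def Loads (n : ℕ) (I : Language Γ) (r : List (Letter n Γ)) (u : List Γ) : Prop :=
  r = u.map row ∨ ∃ m, r = List.replicate m pad ∧ u.length ≤ m ∧ u ∈ I

/-- The edges labelled by `a` of the new graph. -/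
inductive QueueEdge (G : RationalGraph A Γ) (I : Language Γ) (enc : A ≃ Fin n) (C : ℕ) (a : A) :
    List (Letter n Γ) → List (Letter n Γ) → Prop
  | grow (α m) : QueueEdge G I enc C a (queueWord Γ enc α ++ List.replicate m pad)
      (queueWord Γ enc (α ++ [a]) ++ List.replicate (m * C) pad)
  | last {r u v} : Loads n I r u → G.Path u [a] v → QueueEdge G I enc C a r (v.map row)
  | lastTwo {b r u v} : Loads n I r u → G.Path u [b, a] v →
      QueueEdge G I enc C a (queueWord Γ enc [b] ++ r) (v.map row)
  | two {b c α r u v} : Loads n I r u → G.Path u [b, c] v →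
      QueueEdge G I enc C a (queueWord Γ enc (b :: c :: α) ++ r)
        (queueWord Γ enc (α ++ [a]) ++ v.map row)

open Transducer

theorem isRational_loads {I : Language Γ} (hI : I.IsRegular) :
    IsRational fun x y => ∃ u : List Γ, y = u.map row ∧ Loads n I x u := by
  obtain ⟨σ, _, M, rfl⟩ := hI
  refine ((isRational_map_diagonal (row : Γ → Letter n Γ)).or
    ⟨fill M pad row, fun x y => accepts_fill M pad row x y⟩).congr fun x y => ⟨?_, ?_⟩
  · rintro (⟨u, rfl, rfl⟩ | ⟨m, u, hu, rfl, rfl, hl⟩)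
    · exact ⟨u, rfl, .inl rfl⟩
    · exact ⟨u, rfl, .inr ⟨m, rfl, hl, hu⟩⟩
  · rintro ⟨u, rfl, rfl | ⟨m, rfl, hl, hu⟩⟩
    · exact .inl ⟨u, rfl, rfl⟩
    · exact .inr ⟨m, u, hu, rfl, rfl, hl⟩

theorem isRational_loads_path [Finite A] {G : RationalGraph A Γ} (hG : G.IsSynchronous)
    {I : Language Γ} (hI : I.IsRegular) (w : List A) :
    IsRational fun x y => ∃ v : List Γ, y = v.map row ∧ ∃ u, Loads n I x u ∧ G.Path u w v := by
  obtain ⟨S, hS⟩ := isRational_loads (n := n) hI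
  obtain ⟨q, hq⟩ := Finite.exists_le fun a => Nat.card (G.T a).State
  obtain ⟨T, -, hT⟩ := exists_transducer_path hG hq (row_injective (n := n)) w S fun x y h => by
    obtain ⟨u, rfl, _⟩ := (hS x y).1 h
    exact ⟨u, rfl⟩
  refine ⟨T, fun x y => (hT x y).trans ⟨?_, ?_⟩⟩
  · rintro ⟨u, v, rfl, h, hp⟩
    obtain ⟨u', huu', h⟩ := (hS _ _).1 h
    obtain rfl := List.map_injective_iff.2 row_injective huu'
    exact ⟨v, rfl, u, h, hp⟩
  · rintro ⟨v, rfl, u, h, hp⟩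
    exact ⟨u, v, rfl, (hS _ _).2 ⟨u, rfl, h⟩, hp⟩

theorem isRational_queueWord (enc : A ≃ Fin n) :
    IsRational fun x y => ∃ α, x = queueWord Γ enc α ∧ y = queueWord Γ enc α := by
  refine (isRational_flatMap (fun b : Fin n => [(queue b : Letter n Γ)]) fun b => [queue b]).congr
    fun x y => ⟨?_, ?_⟩
  · rintro ⟨l, rfl, rfl⟩
    exact ⟨l.map enc.symm, by simp [queueWord, ← List.map_eq_flatMap],
      by simp [queueWord, ← List.map_eq_flatMap]⟩
  · rintro ⟨α, rfl, rfl⟩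
    exact ⟨α.map enc, by simp [queueWord, ← List.map_eq_flatMap, Function.comp_def],
      by simp [queueWord, ← List.map_eq_flatMap, Function.comp_def]⟩

theorem isRational_pad (C : ℕ) : IsRational fun x y => ∃ m,
    x = List.replicate m (pad : Letter n Γ) ∧ y = List.replicate (m * C) pad := by
  have h : ∀ (k : ℕ) (l : List Unit), l.flatMap (fun _ => List.replicate k (pad : Letter n Γ)) =
      List.replicate (l.length * k) pad := by
    intro k l
    induction l with
    | nil => simp
    | cons _ l ih => rw [List.flatMap_cons, ih, List.replicate_append_replicate, List.length_cons,
        Nat.succ_mul, add_comm]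
  refine (isRational_flatMap (fun _ : Unit => List.replicate 1 pad)
    fun _ : Unit => List.replicate C pad).congr fun x y => ?_
  simp only [h, mul_one]
  exact ⟨fun ⟨l, hl⟩ => ⟨l.length, hl⟩, fun ⟨m, hm⟩ => ⟨List.replicate m (), by simpa using hm⟩⟩

/-- Each kind of edge is a concatenation of rational relations: delete at most two queue letters,
copy the rest, insert `a`, and transform the row. Only the letters deleted or simulated need to be
remembered, and there are finitely many choices. -/
theorem isRational_queueEdge [Finite A] {G : RationalGraph A Γ} (hG : G.IsSynchronous)
    {I : Language Γ} (hI : I.IsRegular) (enc : A ≃ Fin n) (C : ℕ) (a : A) :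
    IsRational (QueueEdge G I enc C a) := by
  have hq := isRational_queueWord (Γ := Γ) enc
  have ha := isRational_singleton [] (queueWord Γ enc [a])
  have grow := hq.cat (ha.cat (isRational_pad C))
  have last := isRational_loads_path (n := n) hG hI [a]
  -- The dequeued letters are indexed through `Fin n` because `iUnion` takes its index in `Type`.
  have lastTwo := IsRational.iUnion fun b : Fin n =>
    (isRational_singleton (queueWord Γ enc [enc.symm b]) []).cat
      (isRational_loads_path (n := n) hG hI [enc.symm b, a])
  have two := IsRational.iUnion fun b : Fin n × Fin n =>
    (isRational_singleton (queueWord Γ enc [enc.symm b.1, enc.symm b.2]) []).cat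
      (hq.cat (ha.cat (isRational_loads_path (n := n) hG hI [enc.symm b.1, enc.symm b.2])))
  refine (grow.or (last.or (lastTwo.or two))).congr fun x y => ⟨?_, ?_⟩
  · rintro (h | h | h | h)
    · obtain ⟨_, _, _, _, rfl, rfl, ⟨α, rfl, rfl⟩, _, _, _, _, rfl, rfl, ⟨rfl, rfl⟩, m, rfl, rfl⟩ := h
      simpa [queueWord] using QueueEdge.grow (G := G) (I := I) (enc := enc) (C := C) (a := a) α m
    · obtain ⟨v, rfl, u, h, hp⟩ := h
      exact .last h hp
    · obtain ⟨b, _, _, _, _, rfl, rfl, ⟨rfl, rfl⟩, v, rfl, u, h, hp⟩ := h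
      exact .lastTwo h hp
    · obtain ⟨b, _, _, _, _, rfl, rfl, ⟨rfl, rfl⟩, _, _, _, _, rfl, rfl, ⟨α, rfl, rfl⟩,
        _, _, _, _, rfl, rfl, ⟨rfl, rfl⟩, v, rfl, u, h, hp⟩ := h
      simpa [queueWord] using QueueEdge.two (enc := enc) (C := C) (a := a) (α := α) h hp
  · rintro (⟨α, m⟩ | ⟨h, hp⟩ | ⟨h, hp⟩ | ⟨h, hp⟩)
    · refine .inl ⟨_, _, queueWord Γ enc α, _, rfl, ?_, ⟨α, rfl, rfl⟩, [], _, _, _, rfl, rfl,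
        ⟨rfl, rfl⟩, m, rfl, rfl⟩
      simp [queueWord]
    · exact .inr (.inl ⟨_, rfl, _, h, hp⟩)
    · rename_i b r u v
      exact .inr (.inr (.inl ⟨enc b, _, r, [], _, rfl, rfl, by simp, v, rfl, u, h, by simpa⟩))
    · rename_i b c α r u v
      refine .inr (.inr (.inr ⟨(enc b, enc c), queueWord Γ enc [b, c], _, [], _, ?_, rfl, by simp,
        queueWord Γ enc α, _, queueWord Γ enc α, _, rfl, ?_, ⟨α, rfl, rfl⟩, [], r, _, _, rfl, rfl,
        ⟨rfl, rfl⟩, v, rfl, u, h, by simpa⟩))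
      · simp [queueWord]
      · simp [queueWord]

theorem QueueEdge.length_le {G : RationalGraph A Γ} (hG : G.IsSynchronous) {I : Language Γ}
    {enc : A ≃ Fin n} {C : ℕ} {a : A} {x y : List (Letter n Γ)}
    (h : QueueEdge G I enc C a x y) : y.length ≤ x.length * (C + 1) + 1 := by
  -- Synchronous edges preserve length and a loaded word fits into its padding, so only `grow` needs
  -- the factor `C`.
  have hl : ∀ {r u v w}, Loads n I r u → G.Path u w v → v.length ≤ r.length := by
    rintro r u v w (rfl | ⟨m, rfl, hm, -⟩) hp
    · simpa using (hG.length_eq hp).ge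
    · simpa using (hG.length_eq hp).ge.trans hm
  cases h with
  | grow α m => simp [queueWord]; nlinarith
  | last h hp => have := hl h hp; simp; nlinarith
  | lastTwo h hp => have := hl h hp; simp [queueWord]; nlinarith
  | two h hp => have := hl h hp; simp [queueWord]; nlinarith

/-! ### Paths of the new graph -/

/-- The word in the queue of a vertex. -/
def queueOf (enc : A ≃ Fin n) (x : List (Letter n Γ)) : List A :=
  x.filterMap fun
    | queue b => some (enc.symm b)
    | _ => none

/-- The row of a vertex. -/
def rowOf (x : List (Letter n Γ)) : List (Letter n Γ) :=
  x.filterMap fun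
    | queue _ => none
    | l => some l

@[simp] theorem queueOf_append (enc : A ≃ Fin n) (x y : List (Letter n Γ)) :
    queueOf enc (x ++ y) = queueOf enc x ++ queueOf enc y := List.filterMap_append

@[simp] theorem rowOf_append (x y : List (Letter n Γ)) :
    rowOf (x ++ y) = rowOf x ++ rowOf y := List.filterMap_append

@[simp] theorem queueOf_queueWord (enc : A ≃ Fin n) (α : List A) :
    queueOf enc (queueWord Γ enc α) = α := by
  simp [queueOf, queueWord, List.filterMap_map]

@[simp] theorem rowOf_queueWord (enc : A ≃ Fin n) (α : List A) :
    rowOf (queueWord Γ enc α) = [] := by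
  simp [rowOf, queueWord, List.filterMap_map]

@[simp] theorem queueOf_map_row (enc : A ≃ Fin n) (u : List Γ) :
    queueOf enc (u.map row) = [] := by
  simp [queueOf, List.filterMap_map]

@[simp] theorem rowOf_map_row (u : List Γ) :
    rowOf (u.map row : List (Letter n Γ)) = u.map row := by
  simp [rowOf, List.filterMap_map, List.filterMap_eq_map']

@[simp] theorem queueOf_pad (enc : A ≃ Fin n) (m : ℕ) :
    queueOf enc (List.replicate m (pad : Letter n Γ)) = [] := by
  simp [queueOf]

@[simp] theorem rowOf_pad (m : ℕ) :
    rowOf (List.replicate m (pad : Letter n Γ)) = List.replicate m pad := by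
  simp [rowOf]

theorem Loads.queueOf_eq_nil {I : Language Γ} {r : List (Letter n Γ)} {u : List Γ}
    (h : Loads n I r u) (enc : A ≃ Fin n) : queueOf enc r = [] := by
  obtain rfl | ⟨m, rfl, -⟩ := h <;> simp

theorem Loads.rowOf_eq {I : Language Γ} {r : List (Letter n Γ)} {u : List Γ}
    (h : Loads n I r u) : rowOf r = r := by
  obtain rfl | ⟨m, rfl, -⟩ := h <;> simp

/-- A variant of `Loads` without the bound on the length. -/
def LoadsWeakly (n : ℕ) (I : Language Γ) (r : List (Letter n Γ)) (u : List Γ) : Prop :=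
  r = u.map row ∨ ∃ m, 0 < m ∧ r = List.replicate m pad ∧ u ∈ I

theorem Loads.weakly {I : Language Γ} {r : List (Letter n Γ)} {u : List Γ}
    (h : Loads n I r u) : LoadsWeakly n I r u := by
  -- An empty block of padding is also the empty row; the length bound then forces `u = []`.
  obtain rfl | ⟨_ | m, rfl, hm, hu⟩ := h
  · exact .inl rfl
  · obtain rfl := List.length_eq_zero_iff.1 (Nat.le_zero.1 hm)
    exact .inl rfl
  · exact .inr ⟨m + 1, m.succ_pos, rfl, hu⟩

/-- Undoing a growth step may leave padding too short for `u`, which is why the length bound is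
dropped. -/
theorem LoadsWeakly.of_grow {I : Language Γ} {C m : ℕ} (hC : 0 < C) {u : List Γ}
    (h : LoadsWeakly n I (List.replicate (m * C) pad) u) :
    LoadsWeakly n I (List.replicate m pad) u := by
  obtain rfl | hm := Nat.eq_zero_or_pos m
  · simpa using h
  obtain h | ⟨_, _, _, hu⟩ := h
  · have : (pad : Letter n Γ) ∈ u.map row := h ▸ by simp [hm.ne', hC.ne']
    simp at this
  · exact .inr ⟨m, hm, rfl, hu⟩

/-- Positivity of the padding matters for `v = []`: an empty block would otherwise load any word of
`I`. -/
theorem LoadsWeakly.eq_of_map_row {I : Language Γ} {u v : List Γ}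
    (h : LoadsWeakly n I (v.map row) u) : u = v := by
  obtain h | ⟨m, hm, h, _⟩ := h
  · exact (List.map_injective_iff.2 row_injective h).symm
  · have : (pad : Letter n Γ) ∈ v.map row := h ▸ by simp [hm.ne']
    simp at this

variable {G : RationalGraph A Γ} {I : Language Γ} {enc : A ≃ Fin n} {C : ℕ}
  {H : RationalGraph A (Letter n Γ)}

/-- By induction from the end of the path: the letters still owed by a vertex are its queue followed
by the unread input. Every kind of edge respects this order, so nothing need be known about when
growth stops. -/
theorem path_sound (hC : 0 < C) (hH : ∀ x a y, H.Edge x a y → QueueEdge G I enc C a x y)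
    {x : List (Letter n Γ)} {w : List A} {t : List Γ} (h : H.Path x w (t.map row)) :
    ∃ u, LoadsWeakly n I (rowOf x) u ∧ G.Path u (queueOf enc x ++ w) t := by
  generalize hy : t.map row = y at h
  induction h with
  | nil s =>
    subst hy
    exact ⟨t, .inl (by simp), by simpa using .nil t⟩
  | cons he _ ih =>
    obtain ⟨u, hu, hp⟩ := ih hy
    cases hH _ _ _ he with
    | grow α m =>
      simp only [rowOf_append, rowOf_queueWord, rowOf_pad, List.nil_append, queueOf_append,
        queueOf_queueWord, queueOf_pad, List.append_nil, List.append_assoc,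
        List.singleton_append] at hu hp ⊢
      exact ⟨u, hu.of_grow hC, hp⟩
    | last h hp' =>
      simp only [rowOf_map_row, queueOf_map_row, List.nil_append] at hu hp
      obtain rfl := hu.eq_of_map_row
      rw [h.queueOf_eq_nil, h.rowOf_eq]
      exact ⟨_, h.weakly, hp'.trans hp⟩
    | lastTwo h hp' =>
      simp only [rowOf_map_row, queueOf_map_row, List.nil_append] at hu hp
      obtain rfl := hu.eq_of_map_row
      rw [queueOf_append, rowOf_append, h.queueOf_eq_nil, h.rowOf_eq, queueOf_queueWord,
        rowOf_queueWord]
      exact ⟨_, h.weakly, hp'.trans hp⟩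
    | two h hp' =>
      simp only [rowOf_append, rowOf_queueWord, rowOf_map_row, List.nil_append, queueOf_append,
        queueOf_queueWord, queueOf_map_row, List.append_nil, List.append_assoc,
        List.singleton_append] at hu hp
      obtain rfl := hu.eq_of_map_row
      rw [queueOf_append, rowOf_append, h.queueOf_eq_nil, h.rowOf_eq, queueOf_queueWord,
        rowOf_queueWord, List.append_nil]
      exact ⟨_, h.weakly, hp'.trans hp⟩

/-- A `two` edge shortens queue and input by one each, so the difference of their lengths, 0 or 1,
is kept until a final edge. Only the first edge may load from padding; later rows are words over
`Γ`. -/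
theorem path_process (hH : ∀ x a y, QueueEdge G I enc C a x y → H.Edge x a y) {w : List A} :
    ∀ {α : List A} {r : List (Letter n Γ)} {u t : List Γ}, Loads n I r u → G.Path u (α ++ w) t →
      w ≠ [] → w.length = α.length ∨ w.length = α.length + 1 →
      H.Path (queueWord Γ enc α ++ r) w (t.map row) := by
  induction w with
  | nil => simp
  | cons a w ih =>
    intro α r u t hr hp _ hl
    match α, hp, hl with
    | [], hp, hl =>
      obtain rfl : w = [] := by simpa using hl
      exact .cons (hH _ _ _ (.last hr hp)) (.nil _)
    | [b], hp, hl =>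
      obtain ⟨s, h1, h2⟩ := path_append (w := [b, a]).1 hp
      refine .cons (hH _ _ _ (.lastTwo hr h1)) ?_
      -- With equal lengths this was the last edge; otherwise one letter remains for an empty queue.
      obtain rfl | hw := eq_or_ne w []
      · cases h2
        exact .nil _
      · have : w.length ≠ 0 := by simpa using hw
        refine ih (α := []) (.inl rfl) h2 hw ?_
        simp at hl ⊢
        omega
    | b :: c :: α, hp, hl =>
      obtain ⟨s, h1, h2⟩ := path_append (w := [b, c]) (z := α ++ a :: w).1 (by simpa using hp)
      refine .cons (hH _ _ _ (.two hr h1)) (ih (.inl rfl) (by simpa using h2) ?_ ?_)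
      · rintro rfl
        simp at hl
      · simp at hl ⊢
        omega

theorem path_grow (hH : ∀ x a y, QueueEdge G I enc C a x y → H.Edge x a y) (w : List A) :
    ∀ (α : List A) (m : ℕ), H.Path (queueWord Γ enc α ++ List.replicate m pad) w
      (queueWord Γ enc (α ++ w) ++ List.replicate (m * C ^ w.length) pad) := by
  induction w with
  | nil => intro α m; simpa using Path.nil _
  | cons a w ih =>
    intro α m
    have := ih (α ++ [a]) (m * C)
    rw [List.append_assoc, mul_assoc, ← pow_succ'] at this
    exact .cons (hH _ _ _ (.grow α m)) this

end RationalGraph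

/-! ### Choice of the constants and equality of the languages -/

theorem mainTheorem12 {A : Type u} {Γ : Type v} [Finite A] [Finite Γ]
    (G : RationalGraph A Γ) (hG : G.IsSynchronous)
    (I F : Language Γ) (hI : I.IsRegular) (hF : F.IsRegular) (hIF : I ⊓ F = ⊥) :
    ∃ (Γ' : Type v) (_ : Finite Γ') (e : Γ ↪ Γ') (H : RationalGraph A Γ') (i : List Γ'),
      H.FiniteOutDegree ∧
        G.language I F = H.language {i} (Language.map e F) := by
  classical
  obtain ⟨n, ⟨enc⟩⟩ := Finite.exists_equiv_fin A
  obtain ⟨q', hq'⟩ := Finite.exists_le fun a => Nat.card (G.T a).State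
  -- The bound is raised by one to be positive even when there are no labels.
  obtain ⟨q, hq, hq0⟩ : ∃ q, (∀ a, Nat.card (G.T a).State ≤ q) ∧ 0 < q :=
    ⟨q' + 1, fun a => (hq' a).trans q'.le_succ, q'.succ_pos⟩
  obtain ⟨σ, _, M, hM⟩ := id hI
  obtain ⟨τ, _, N, hN⟩ := id hF
  have : Nonempty σ := ⟨M.start⟩
  have : Nonempty τ := ⟨N.start⟩
  set c := Nat.card σ * Nat.card τ with hc
  have hc0 : 0 < c := Nat.mul_pos Nat.card_pos Nat.card_pos
  -- One growth step pays for two letters of `w`, hence the square.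
  set C := c * q ^ 2 with hC
  have hC0 : 0 < C := by positivity
  choose T hT using fun a => RationalGraph.isRational_queueEdge hG hI enc C a
  let H : RationalGraph A (RationalGraph.Letter n Γ) := ⟨T⟩
  have hH : ∀ x a y, H.Edge x a y ↔ G.QueueEdge I enc C a x y := fun x a y => hT a x y
  refine ⟨RationalGraph.Letter n Γ, inferInstance, ⟨.row, RationalGraph.Letter.row_injective⟩, H,
    List.replicate C .pad, fun s => ?_, ?_⟩
  · refine (Set.finite_univ.prod
      (List.finite_length_le (RationalGraph.Letter n Γ) (s.length * (C + 1) + 1))).subset ?_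
    exact fun e he => ⟨trivial, ((hH _ _ _).1 he).length_le hG⟩
  · ext w
    constructor
    · rintro ⟨s, hs, t, ht, hp⟩
      have hw : w ≠ [] := by
        rintro rfl
        cases hp
        exact (hIF ▸ (⟨hs, ht⟩ : s ∈ I ⊓ F) : s ∈ (⊥ : Language Γ))
      subst hM hN
      obtain ⟨s, hs, t, ht, hp, hl⟩ := RationalGraph.exists_path_length_lt hG hq M N hp hs ht
      refine ⟨_, rfl, t.map .row, ⟨t, ht, rfl⟩, ?_⟩
      have hgrow := RationalGraph.path_grow (fun x a y => (hH x a y).2) (w.take (w.length / 2)) [] C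
      have hlen : (w.take (w.length / 2)).length = w.length / 2 := by
        rw [List.length_take]; omega
      have hw' : w.length ≠ 0 := by simpa using hw
      rw [← List.take_append_drop (w.length / 2) w]
      refine .trans hgrow
        (RationalGraph.path_process (u := s) (fun x a y => (hH x a y).2) (.inr ⟨_, rfl, ?_, hs⟩)
          (by simpa using hp) ?_ ?_)
      -- The initial block already has length `C`; this extra factor covers an odd length of `w`,
      -- since `|w| ≤ 2 * (|w| / 2 + 1)`, and the constant `c`.
      · rw [hlen, ← pow_succ', hC]
        refine hl.le.trans ?_
        calc Nat.card σ * q ^ w.length * Nat.card τ = c * q ^ w.length := by rw [hc]; ring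
          _ ≤ c ^ (w.length / 2 + 1) * q ^ (2 * (w.length / 2 + 1)) :=
              Nat.mul_le_mul (Nat.le_self_pow (Nat.succ_ne_zero _) c)
                (Nat.pow_le_pow_right hq0 (by omega))
          _ = (c * q ^ 2) ^ (w.length / 2 + 1) := by rw [mul_pow c, ← pow_mul]
      · rw [Ne, List.drop_eq_nil_iff]
        omega
      · rw [List.nil_append, hlen, List.length_drop]
        omega
    · rintro ⟨_, rfl, _, ⟨t, ht, rfl⟩, hp⟩
      obtain ⟨u, hu, hp⟩ := RationalGraph.path_sound hC0 (fun x a y => (hH x a y).1) hp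
      refine ⟨u, ?_, t, ht, by simpa using hp⟩
      -- The start vertex is nonempty padding, hence not a row over `Γ`, so `u` was chosen in `I`.
      obtain h | ⟨_, _, _, h⟩ := hu
      · have : (RationalGraph.Letter.pad : RationalGraph.Letter n Γ) ∈ u.map .row :=
          h ▸ by simp [hC0.ne']
        simp at this
      · exact h
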